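/- Let $\mathbb{T}=abacabaabacab\cdots$ be the Tribonacci sequence, the infinite fixed point beginning with $a$ of the substitution $a\mapsto ab$, $b\mapsto ac$, $c\mapsto a$. Let $t_m$ be the Tribonacci numbers, $t_{-2}=0$, $t_{-1}=t_0=1$, $t_m=t_{m-1}+t_{m-2}+t_{m-3}$ for $m\ge 1$, and let $k_m$ be the kernel numbers, $k_0=0$, $k_1=k_2=1$, $k_m=k_{m-1}+k_{m-2}+k_{m-3}-1$ for $m\ge 3$. For $n\ge 1$ let $B(n)$ be the number of repeated palindromes in the prefix $\mathbb{T}[1,n]$ of length $n$, i.e. the number of pairs $(\omega,p)$ with $p\ge1$ such that $\omega$ is a nonempty palindrome occurring in $\mathbb{T}$ and the $p$-th occurrence of $\omega$ in $\mathbb{T}$ (occurrences ordered by position) lies inside $\mathbb{T}[1,n]$. Then for every integer $m\ge 1$, $$B(k_{m+4}-2)=\frac{m}{44}\left(8t_{m+2}+4t_{m+1}-2t_m\right)-\frac{1}{44}\left(9t_{m+2}-3t_m\right)+\frac34 .$$ -/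

import Mathlib

namespace TribonacciPalindromes

/-- The alphabet `{a, b, c}`, with `a = 0`, `b = 1`, `c = 2`. -/
abbrev Letter : Type := Fin 3

/-- The substitution `τ` on letters: `a ↦ ab`, `b ↦ ac`, `c ↦ a`. -/
def tau (x : Letter) : List Letter :=
  if x = 0 then [0, 1] else if x = 1 then [0, 2] else [0]

/-- The finite Tribonacci words `T_m = τ^m(a)`, `m ≥ 0`. -/
def finiteWord : ℕ → List Letter
  | 0 => [0]
  | m + 1 => (finiteWord m).flatMap tau

/-- The Tribonacci numbers `t_m` for `m ≥ 0`; the initial values `1, 2, 4` are those produced by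
`t_{-2} = 0`, `t_{-1} = t_0 = 1` and `t_m = t_{m-1} + t_{m-2} + t_{m-3}` for `m ≥ 1`. -/
def t : ℕ → ℕ
  | 0 => 1
  | 1 => 2
  | 2 => 4
  | m + 3 => t (m + 2) + t (m + 1) + t m

/-- The kernel numbers: `k_0 = 0`, `k_1 = k_2 = 1`, `k_m = k_{m-1} + k_{m-2} + k_{m-3} - 1` for
`m ≥ 3`. The subtraction never truncates, see `k_succ_pos`. -/
def k : ℕ → ℕ
  | 0 => 0
  | 1 => 1
  | 2 => 1
  | m + 3 => k (m + 2) + k (m + 1) + k m - 1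

/-- The infinite Tribonacci sequence, the fixed point of `τ` starting with `a`, indexed from `0`:
`word i` is the letter at position `i + 1`. It is read off from `T_i`, which has more than `i`
letters (`lt_length_finiteWord`), and every `T_m` is a prefix of it (`block_zero_length`). -/
def word (i : ℕ) : Letter := (finiteWord i).getD i 0

/-- The block of length `l` of the Tribonacci sequence that starts at the index `i`
(counted from `0`). -/
def block (i l : ℕ) : List Letter := (List.range l).map fun j => word (i + j)

/-- `ω` occurs in the Tribonacci sequence with its first letter at index `i`. -/
def OccursAt (ω : List Letter) (i : ℕ) : Prop := block i ω.length = ω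

instance (ω : List Letter) : DecidablePred (OccursAt ω) :=
  fun i => inferInstanceAs (Decidable (block i ω.length = ω))

/-- The `p`-th occurrence `ω_p` (`p ≥ 1`) of `ω` is the one that starts at index `i`: `ω` occurs
there, and exactly `p` occurrences of `ω` start at an index at most `i`. -/
def IsPthOccurrence (ω : List Letter) (p i : ℕ) : Prop :=
  OccursAt ω i ∧ Nat.count (OccursAt ω) (i + 1) = p

/-- The nonempty palindromes that occur in the Tribonacci sequence. -/
def palindromes : Set (List Letter) :=
  {ω | ω ≠ [] ∧ ω.Palindrome ∧ ∃ i, OccursAt ω i}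

/-- `B n` is the number of pairs `(ω, p)` such that `ω` is a nonempty palindrome occurring in the
Tribonacci sequence and its `p`-th occurrence lies inside the prefix of length `n`. -/
noncomputable def B (n : ℕ) : ℕ :=
  Set.ncard {q : List Letter × ℕ |
    q.1 ∈ palindromes ∧ ∃ i, IsPthOccurrence q.1 q.2 i ∧ i + q.1.length ≤ n}

theorem k_succ_pos (m : ℕ) : 1 ≤ k (m + 1) := by
  have h : 1 ≤ k (m + 1) ∧ 1 ≤ k (m + 2) := by
    induction m with
    | zero => simp [k]
    | succ m ih =>
      refine ⟨ih.2, ?_⟩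
      have := ih.1
      have := ih.2
      simp only [k]
      omega
  exact h.1

theorem two_le_k (m : ℕ) : 2 ≤ k (m + 4) := by
  have h1 : 1 ≤ k (m + 1) := k_succ_pos m
  have h2 : 1 ≤ k (m + 2) := k_succ_pos (m + 1)
  have h3 : 1 ≤ k (m + 3) := k_succ_pos (m + 2)
  have h : k (m + 4) = k (m + 3) + k (m + 2) + k (m + 1) - 1 := rfl
  omega

theorem finiteWord_prefix_succ (m : ℕ) : finiteWord m <+: finiteWord (m + 1) := by
  induction m with
  | zero => exact ⟨[1], rfl⟩
  | succ m ih =>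
    obtain ⟨u, hu⟩ := ih
    refine ⟨u.flatMap tau, ?_⟩
    show (finiteWord m).flatMap tau ++ u.flatMap tau = (finiteWord (m + 1)).flatMap tau
    rw [← hu, List.flatMap_append]

theorem finiteWord_prefix {m n : ℕ} (h : m ≤ n) : finiteWord m <+: finiteWord n := by
  induction n, h using Nat.le_induction with
  | base => exact List.prefix_refl _
  | succ n _ ih => exact ih.trans (finiteWord_prefix_succ n)

theorem finiteWord_eq_append (m : ℕ) :
    finiteWord (m + 3) = finiteWord (m + 2) ++ finiteWord (m + 1) ++ finiteWord m := by
  induction m with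
  | zero => decide
  | succ m ih =>
    have h := congrArg (List.flatMap tau) ih
    rw [List.flatMap_append, List.flatMap_append] at h
    exact h

theorem length_finiteWord : ∀ m : ℕ, (finiteWord m).length = t m
  | 0 => rfl
  | 1 => rfl
  | 2 => rfl
  | m + 3 => by
    rw [finiteWord_eq_append, List.length_append, List.length_append, length_finiteWord (m + 2),
      length_finiteWord (m + 1), length_finiteWord m]
    rfl

theorem lt_t : ∀ m : ℕ, m < t m
  | 0 => by decide
  | 1 => by decide
  | 2 => by decide
  | m + 3 => by
    have h2 := lt_t (m + 2)
    have h1 := lt_t (m + 1)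
    have h0 := lt_t m
    simp only [t]
    omega

theorem lt_length_finiteWord (m : ℕ) : m < (finiteWord m).length := by
  rw [length_finiteWord]
  exact lt_t m

theorem block_zero_length (m : ℕ) : block 0 (finiteWord m).length = finiteWord m := by
  apply List.ext_getElem
  · simp [block]
  · intro i h1 h2
    have hi := lt_length_finiteWord i
    simp only [block, word, List.getElem_map, List.getElem_range, Nat.zero_add]
    rw [List.getD_eq_getElem _ _ hi]
    rcases le_total i m with h | h
    · exact (finiteWord_prefix h).getElem hi
    · exact ((finiteWord_prefix h).getElem h2).symm

end TribonacciPalindromes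

namespace TribonacciPalindromes

/-! `B n` counts the pairs of indices that bound a nonempty palindrome inside the prefix of length
`n`, and these pairs desubstitute. The map `u ↦ τ(u)a` preserves and reflects palindromes. It
matches all palindromic occurrences in the prefix of length `n`, empty ones included, with those
beginning with `a` in the prefix of length `start n + 1` (`card_palsFrom_zero`). Deleting the outer
letters of `τ(u)a` matches those beginning with `a` or `b` with those beginning with `b` or `c`
(`card_palsFrom_add_one`). Along the palindromic prefixes `palPrefix m`, of length `k (m + 4) - 2`,
splitting by first letter gives the recurrence `B_palPrefix_add_three`, which the closed form
satisfies with the same initial values. -/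

theorem length_block (i l : ℕ) : (block i l).length = l := by simp [block]

theorem block_add (i l l' : ℕ) : block i (l + l') = block i l ++ block (i + l) l' := by
  simp only [block, List.range_add, List.map_append, List.map_map]
  congr 1
  apply List.map_congr_left
  intro j _
  simp [add_assoc]

theorem block_one (i : ℕ) : block i 1 = [word i] := by simp [block]

theorem block_succ (i l : ℕ) : block i (l + 1) = block i l ++ [word (i + l)] := by
  rw [block_add, block_one]

theorem block_succ' (i l : ℕ) : block i (l + 1) = word i :: block (i + 1) l := by
  rw [add_comm, block_add, block_one]; rfl

theorem eq_block_of_prefix {u : List Letter} {m : ℕ} (h : u <+: finiteWord m) :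
    u = block 0 u.length := by
  rw [← block_zero_length m] at h
  obtain ⟨l', hl⟩ := Nat.exists_eq_add_of_le h.length_le
  rw [length_block] at hl
  rw [hl, block_add] at h
  exact (List.prefix_of_prefix_length_le h (List.prefix_append _ _)
    (by rw [length_block])).eq_of_length (by rw [length_block])

theorem block_prefix (i : ℕ) : block 0 i <+: finiteWord i := by
  obtain ⟨l', hl⟩ := Nat.exists_eq_add_of_le (lt_length_finiteWord i).le
  rw [← block_zero_length i, hl, block_add]
  exact List.prefix_append _ _

/-! ### Desubstitution of positions -/

/-- The index at which the image under `τ` of the letter with index `i` starts. -/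
def start (i : ℕ) : ℕ := ((block 0 i).flatMap tau).length

theorem start_zero : start 0 = 0 := rfl

theorem start_succ (i : ℕ) : start (i + 1) = start i + (tau (word i)).length := by
  simp [start, block_succ]

theorem flatMap_block_zero (i : ℕ) : (block 0 i).flatMap tau = block 0 (start i) := by
  apply eq_block_of_prefix (m := i + 1)
  obtain ⟨u, hu⟩ := block_prefix i
  exact ⟨u.flatMap tau, by rw [← List.flatMap_append, hu]; rfl⟩

theorem tau_word (i : ℕ) : tau (word i) = block (start i) (tau (word i)).length := by
  have h := flatMap_block_zero (i + 1)
  rw [start_succ, block_succ, block_add, List.flatMap_append, flatMap_block_zero] at h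
  simpa using h

theorem letter_cases (x : Letter) : x = 0 ∨ x = 1 ∨ x = 2 := by
  revert x; decide

theorem word_start (i : ℕ) : word (start i) = 0 := by
  have h := tau_word i
  rcases letter_cases (word i) with hx | hx | hx <;> rw [hx] at h <;>
    simp [tau, block_succ'] at h <;> tauto

theorem start_succ_of_eq_two {i : ℕ} (h : word i = 2) : start (i + 1) = start i + 1 := by
  rw [start_succ, h]; rfl

theorem start_succ_of_ne_two {i : ℕ} (h : word i ≠ 2) :
    start (i + 1) = start i + 2 ∧ word (start i + 1) = word i + 1 := by
  have h' := tau_word i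
  rw [start_succ]
  rcases letter_cases (word i) with hx | hx | hx
  · rw [hx] at h' ⊢
    refine ⟨rfl, ?_⟩
    simp [tau, block_succ'] at h'
    exact h'.2.1.symm
  · rw [hx] at h' ⊢
    refine ⟨rfl, ?_⟩
    simp [tau, block_succ'] at h'
    exact h'.2.1.symm
  · exact absurd hx h

theorem start_strictMono : StrictMono start := by
  refine strictMono_nat_of_lt_succ fun i => ?_
  by_cases h : word i = 2
  · rw [start_succ_of_eq_two h]; omega
  · rw [(start_succ_of_ne_two h).1]; omega

theorem eq_start_or (p : ℕ) :
    (∃ i, p = start i) ∨ ∃ i, word i ≠ 2 ∧ p = start i + 1 := by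
  induction p with
  | zero => exact .inl ⟨0, rfl⟩
  | succ p ih =>
    rcases ih with ⟨i, rfl⟩ | ⟨i, hi, rfl⟩
    · by_cases h : word i = 2
      · exact .inl ⟨i + 1, (start_succ_of_eq_two h).symm⟩
      · exact .inr ⟨i, h, rfl⟩
    · exact .inl ⟨i + 1, (start_succ_of_ne_two hi).1.symm⟩

theorem add_one_ne_zero_of_ne_two {x : Letter} (h : x ≠ 2) : x + 1 ≠ 0 := by
  revert x; decide

/-- The second letter of an image, when there is one, is `b` or `c`, so an `a` can only open an
image. -/
theorem exists_start_of_word_eq_zero {p : ℕ} (h : word p = 0) : ∃ i, p = start i := by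
  rcases eq_start_or p with h' | ⟨i, hi, rfl⟩
  · exact h'
  · rw [(start_succ_of_ne_two hi).2] at h
    exact absurd h (add_one_ne_zero_of_ne_two hi)

theorem exists_start_of_word_eq_add_one {p : ℕ} {x : Letter} (hx : x ≠ 2) (h : word p = x + 1) :
    ∃ i, word i = x ∧ p = start i + 1 := by
  rcases eq_start_or p with ⟨i, rfl⟩ | ⟨i, hi, rfl⟩
  · rw [word_start] at h
    exact absurd h.symm (add_one_ne_zero_of_ne_two hx)
  · rw [(start_succ_of_ne_two hi).2] at h
    exact ⟨i, add_right_cancel h, rfl⟩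

/-! ### Desubstitution of words -/

/-- The word `τ(u)a`. -/
def lift (u : List Letter) : List Letter := u.flatMap tau ++ [0]

/-- The final `a` of the lift is the first letter of the next image, whatever that image is. -/
theorem block_start (i l : ℕ) :
    block (start i) (start (i + l) - start i + 1) = lift (block i l) := by
  induction l with
  | zero => simp [lift, block, word_start]
  | succ l ih =>
    have h1 : start i ≤ start (i + l) := start_strictMono.monotone (Nat.le_add_right _ _)
    have h2 := start_succ (i + l)
    rw [block_succ] at ih ⊢
    rw [show start i + (start (i + l) - start i) = start (i + l) by omega, word_start] at ih
    have ih' := List.append_cancel_right ih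
    rw [← add_assoc, show start i + (start (i + l + 1) - start i) = start (i + l + 1) by omega,
      word_start, show start (i + l + 1) - start i =
        (start (i + l) - start i) + (tau (word (i + l))).length by omega, block_add, ih',
      show start i + (start (i + l) - start i) = start (i + l) by omega, ← tau_word, block_succ]
    simp [lift]

/-- The lift is a string of `a`s with a gap of at most one letter between neighbours, one gap for
each letter of `u`; reversal only reverses the order of the gaps. -/
theorem reverse_lift (u : List Letter) : (lift u).reverse = lift u.reverse := by
  induction u with
  | nil => rfl
  | cons x u ih =>
    have h : ∀ v, lift (v ++ [x]) = lift v ++ (tau x).tail ++ [0] := by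
      intro v
      rcases letter_cases x with rfl | rfl | rfl <;> simp [lift, tau]
    have h' : lift (x :: u) = [0] ++ (tau x).tail ++ lift u := by
      rcases letter_cases x with rfl | rfl | rfl <;> simp [lift, tau]
    have h'' : (tau x).tail.reverse = (tau x).tail := by
      rcases letter_cases x with rfl | rfl | rfl <;> rfl
    rw [List.reverse_cons, h, h', List.reverse_append, List.reverse_append, h'', ih]
    simp

/-- The second letter of the lift, or its absence, reveals the first letter of `u`, because the rest
of the lift again begins with `a`. -/
theorem lift_injective : Function.Injective lift := by
  have hl : ∀ u, ∃ u', lift u = 0 :: u' := by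
    rintro (_ | ⟨x, u⟩)
    · exact ⟨_, rfl⟩
    · rcases letter_cases x with rfl | rfl | rfl <;> exact ⟨_, rfl⟩
  have h0 : ∀ u, lift (0 :: u) = 0 :: 1 :: lift u := fun _ => rfl
  have h1 : ∀ u, lift (1 :: u) = 0 :: 2 :: lift u := fun _ => rfl
  have h2 : ∀ u, lift (2 :: u) = 0 :: lift u := fun _ => rfl
  have hn : lift [] = [0] := rfl
  intro u
  induction u with
  | nil =>
    rintro (_ | ⟨y, v⟩) h
    · rfl
    · obtain ⟨v', hv⟩ := hl v
      rcases letter_cases y with rfl | rfl | rfl <;> simp [h0, h1, h2, hn, hv] at h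
  | cons x u ih =>
    obtain ⟨u', hu⟩ := hl u
    rintro (_ | ⟨y, v⟩) h
    · rcases letter_cases x with rfl | rfl | rfl <;> simp [h0, h1, h2, hn, hu] at h
    · obtain ⟨v', hv⟩ := hl v
      have : x = y ∧ lift u = lift v := by
        rcases letter_cases x with rfl | rfl | rfl <;>
          rcases letter_cases y with rfl | rfl | rfl <;> simp_all
      rw [this.1, ih this.2]

/-- The factor between the indices `i` (included) and `j` (excluded) is its own reversal. -/
def IsPal (i j : ℕ) : Prop := (block i (j - i)).reverse = block i (j - i)

instance (i j : ℕ) : Decidable (IsPal i j) := inferInstanceAs (Decidable (_ = _))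

theorem isPal_start {i j : ℕ} (h : i ≤ j) : IsPal (start i) (start j + 1) ↔ IsPal i j := by
  have hm := start_strictMono.monotone h
  have hb := block_start i (j - i)
  rw [Nat.add_sub_cancel' h] at hb
  rw [IsPal, IsPal, show start j + 1 - start i = start j - start i + 1 by omega, hb,
    reverse_lift]
  exact lift_injective.eq_iff

theorem isPal_trim {p q : ℕ} (h : p < q) (hpq : word p = word q) :
    IsPal p (q + 1) ↔ IsPal (p + 1) q := by
  obtain ⟨d, rfl⟩ := Nat.exists_eq_add_of_le h
  rw [IsPal, IsPal, show p + 1 + d + 1 - p = d + 1 + 1 by omega,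
    show p + 1 + d - (p + 1) = d by omega, block_succ', block_succ, ← hpq]
  simp

theorem word_last {p q : ℕ} (h : p ≤ q) (hp : IsPal p (q + 1)) : word q = word p := by
  obtain ⟨d, rfl⟩ := Nat.exists_eq_add_of_le h
  rw [IsPal, show p + d + 1 - p = d + 1 by omega] at hp
  have hl : (block p (d + 1)).reverse.head? = some (word (p + d)) := by
    rw [block_succ]; simp
  rw [hp, block_succ'] at hl
  simpa using hl.symm

/-! ### Counting palindromic occurrences -/

/-- Occurrences in the prefix of length `n` of nonempty palindromes with first letter `x`. -/
def palsFrom (x : Letter) (n : ℕ) : Finset (ℕ × ℕ) :=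
  (Finset.range (n + 1) ×ˢ Finset.range (n + 1)).filter
    fun q => q.1 < q.2 ∧ word q.1 = x ∧ IsPal q.1 q.2

/-- Occurrences in the prefix of length `n` of nonempty palindromes. -/
def pals (n : ℕ) : Finset (ℕ × ℕ) :=
  (Finset.range (n + 1) ×ˢ Finset.range (n + 1)).filter fun q => q.1 < q.2 ∧ IsPal q.1 q.2

theorem mem_palsFrom {x : Letter} {n : ℕ} {q : ℕ × ℕ} :
    q ∈ palsFrom x n ↔ q.2 ≤ n ∧ q.1 < q.2 ∧ word q.1 = x ∧ IsPal q.1 q.2 := by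
  simp only [palsFrom, Finset.mem_filter, Finset.mem_product, Finset.mem_range]
  constructor
  · rintro ⟨⟨-, h⟩, h'⟩; exact ⟨by omega, h'⟩
  · rintro ⟨h, h'⟩; exact ⟨⟨by omega, by omega⟩, h'⟩

theorem mem_pals {n : ℕ} {q : ℕ × ℕ} :
    q ∈ pals n ↔ q.2 ≤ n ∧ q.1 < q.2 ∧ IsPal q.1 q.2 := by
  simp only [pals, Finset.mem_filter, Finset.mem_product, Finset.mem_range]
  constructor
  · rintro ⟨⟨-, h⟩, h'⟩; exact ⟨by omega, h'⟩
  · rintro ⟨h, h'⟩; exact ⟨⟨by omega, by omega⟩, h'⟩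

theorem card_pals (n : ℕ) :
    (pals n).card = (palsFrom 0 n).card + (palsFrom 1 n).card + (palsFrom 2 n).card := by
  rw [Finset.card_eq_sum_card_fiberwise (f := fun q => word q.1) (t := Finset.univ)
    (fun _ _ => Finset.mem_coe.2 (Finset.mem_univ _)), Fin.sum_univ_three]
  have h : ∀ x, (pals n).filter (fun q => word q.1 = x) = palsFrom x n := by
    intro x; ext q; simp only [Finset.mem_filter, mem_pals, mem_palsFrom]; tauto
  simp only [h]

theorem isPal_self (i : ℕ) : IsPal i i := by simp [IsPal, block]

theorem card_palsFrom_zero (n : ℕ) :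
    (palsFrom 0 (start n + 1)).card = (pals n).card + (n + 1) := by
  -- The diagonal stands for the `n + 1` empty factors, whose lifts are the single letters `a`.
  have hd : Disjoint (pals n) (Finset.range (n + 1)).diag := by
    rw [Finset.disjoint_left]
    intro q hq hq'
    have := (mem_pals.1 hq).2.1
    have := (Finset.mem_diag.1 hq').2
    omega
  have hmem : ∀ q : ℕ × ℕ, q ∈ pals n ∪ (Finset.range (n + 1)).diag ↔
      q.2 ≤ n ∧ q.1 ≤ q.2 ∧ IsPal q.1 q.2 := by
    rintro ⟨i, j⟩
    rw [Finset.mem_union, mem_pals, Finset.mem_diag, Finset.mem_range]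
    constructor
    · rintro (⟨h1, h2, h3⟩ | ⟨h1, h2⟩)
      · exact ⟨h1, h2.le, h3⟩
      · dsimp only at h1 h2 ⊢
        subst h2
        exact ⟨by omega, le_rfl, isPal_self _⟩
    · rintro ⟨h1, h2, h3⟩
      rcases h2.lt_or_eq with h | h
      · exact .inl ⟨h1, h, h3⟩
      · exact .inr ⟨by omega, h⟩
  have hc : (pals n).card + (n + 1) = (pals n ∪ (Finset.range (n + 1)).diag).card := by
    rw [Finset.card_union_of_disjoint hd, Finset.diag_card, Finset.card_range]
  rw [hc]
  symm
  apply Finset.card_bij (fun q _ => (start q.1, start q.2 + 1))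
  · intro q hq
    obtain ⟨h1, h2, h3⟩ := (hmem q).1 hq
    have := start_strictMono.monotone h1
    have := start_strictMono.monotone h2
    exact mem_palsFrom.2 ⟨by dsimp only; omega, by dsimp only; omega, word_start _,
      (isPal_start h2).2 h3⟩
  · intro q _ q' _ h
    simp only [Prod.mk.injEq, Nat.add_right_cancel_iff] at h
    exact Prod.ext (start_strictMono.injective h.1) (start_strictMono.injective h.2)
  · rintro ⟨p, q⟩ hq
    obtain ⟨h1, h2, h3, h4⟩ := mem_palsFrom.1 hq
    dsimp only at h1 h2 h3 h4
    obtain ⟨q, rfl⟩ : ∃ r, q = r + 1 := ⟨q - 1, by omega⟩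
    obtain ⟨j, rfl⟩ := exists_start_of_word_eq_zero
      ((word_last (Nat.lt_succ_iff.1 h2) h4).trans h3)
    obtain ⟨i, rfl⟩ := exists_start_of_word_eq_zero h3
    have hij := start_strictMono.le_iff_le.1 (Nat.lt_succ_iff.1 h2)
    have hjn := start_strictMono.le_iff_le.1 (Nat.succ_le_succ_iff.1 h1)
    exact ⟨(i, j), (hmem _).2 ⟨hjn, hij, (isPal_start hij).1 h4⟩, rfl⟩

theorem card_palsFrom_add_one {x : Letter} (hx : x ≠ 2) (n : ℕ) :
    (palsFrom (x + 1) (start n + 1)).card = (palsFrom x n).card := by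
  have htrim : ∀ {i j : ℕ}, i < j → (IsPal (start i + 1) (start j) ↔ IsPal i j) := by
    intro i j h
    rw [← isPal_trim (start_strictMono h) (by rw [word_start, word_start]), isPal_start h.le]
  symm
  apply Finset.card_bij (fun q _ => (start q.1 + 1, start q.2))
  · intro q hq
    obtain ⟨h1, h2, h3, h4⟩ := mem_palsFrom.1 hq
    obtain ⟨hs, hw⟩ := start_succ_of_ne_two (h3.trans_ne hx)
    have := start_strictMono.monotone h1
    have := start_strictMono.monotone (Nat.succ_le_of_lt h2)
    rw [Nat.succ_eq_add_one] at this
    exact mem_palsFrom.2 ⟨by dsimp only; omega, by dsimp only; omega, by rw [hw, h3],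
      (htrim h2).2 h4⟩
  · intro q _ q' _ h
    simp only [Prod.mk.injEq, Nat.add_right_cancel_iff] at h
    exact Prod.ext (start_strictMono.injective h.1) (start_strictMono.injective h.2)
  · rintro ⟨p, q⟩ hq
    obtain ⟨h1, h2, h3, h4⟩ := mem_palsFrom.1 hq
    dsimp only at h1 h2 h3 h4
    obtain ⟨q, rfl⟩ : ∃ r, q = r + 1 := ⟨q - 1, by omega⟩
    obtain ⟨j, hj, rfl⟩ := exists_start_of_word_eq_add_one hx
      ((word_last (Nat.lt_succ_iff.1 h2) h4).trans h3)
    obtain ⟨i, hi, rfl⟩ := exists_start_of_word_eq_add_one hx h3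
    -- The palindrome ends on the second letter of an image, hence just before the next image:
    -- restoring an `a` on each side yields a full lift.
    have hs : start j + 1 + 1 = start (j + 1) := (start_succ_of_ne_two (hj.trans_ne hx)).1.symm
    have hij : i < j + 1 := Nat.lt_succ_iff.2 (start_strictMono.le_iff_le.1 (by omega))
    have hjn : j < n := start_strictMono.lt_iff_lt.1 (by omega)
    rw [hs] at h4
    exact ⟨(i, j + 1), mem_palsFrom.2 ⟨hjn, hij, hi, (htrim hij).1 h4⟩, by rw [hs]⟩

theorem B_eq_card_pals (n : ℕ) : B n = (pals n).card := by
  rw [B, ← Set.ncard_coe_finset]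
  symm
  refine Set.ncard_congr
    (fun q _ => (block q.1 (q.2 - q.1), Nat.count (OccursAt (block q.1 (q.2 - q.1))) (q.1 + 1)))
    ?_ ?_ ?_
  · rintro ⟨i, j⟩ hq
    obtain ⟨h1, h2, h3⟩ := mem_pals.1 (Finset.mem_coe.1 hq)
    dsimp only at h1 h2 h3
    have ho : OccursAt (block i (j - i)) i := by rw [OccursAt, length_block]
    refine ⟨⟨?_, List.Palindrome.of_reverse_eq h3, i, ho⟩, i, ⟨ho, rfl⟩, ?_⟩
    · exact List.ne_nil_of_length_pos (by dsimp only; rw [length_block]; omega)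
    · dsimp only
      rw [length_block]
      omega
  · rintro ⟨i, j⟩ ⟨i', j'⟩ hq hq' h
    have h2 := (mem_pals.1 (Finset.mem_coe.1 hq)).2.1
    have h2' := (mem_pals.1 (Finset.mem_coe.1 hq')).2.1
    simp only [Prod.mk.injEq] at h h2 h2' ⊢
    obtain ⟨hb, hc⟩ := h
    have hl := congrArg List.length hb
    rw [length_block, length_block] at hl
    have ho : OccursAt (block i (j - i)) i := by rw [OccursAt, length_block]
    have ho' : OccursAt (block i (j - i)) i' := by rw [hb, OccursAt, length_block]
    rw [← hb, Nat.count_succ, Nat.count_succ, if_pos ho, if_pos ho'] at hc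
    -- Two occurrences of the same word with the same rank start at the same index.
    have := Nat.count_injective ho ho' (Nat.add_right_cancel hc)
    omega
  · rintro ⟨ω, p⟩ ⟨⟨hne, hpal, -⟩, i, ⟨ho, hp⟩, hn⟩
    dsimp only at hne hpal ho hp hn
    have hb : block i (i + ω.length - i) = ω := by rw [Nat.add_sub_cancel_left]; exact ho
    have := List.length_pos_iff.2 hne
    refine ⟨(i, i + ω.length), Finset.mem_coe.2 (mem_pals.2 ⟨hn, ?_, ?_⟩), ?_⟩
    · dsimp only; omega
    · rw [IsPal]; dsimp only; rw [hb]; exact hpal.reverse_eq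
    · dsimp only; rw [hb, hp]

/-! ### Palindromic prefixes and the recurrence -/

/-- The palindromic prefixes obtained from the empty word by iterating `u ↦ τ(u)a`. -/
def palPrefix : ℕ → List Letter
  | 0 => []
  | m + 1 => lift (palPrefix m)

theorem palPrefix_eq_block (m : ℕ) : palPrefix m = block 0 (palPrefix m).length := by
  induction m with
  | zero => rfl
  | succ m ih =>
    have h := block_start 0 (palPrefix m).length
    rw [zero_add, start_zero, Nat.sub_zero, ← ih] at h
    change lift _ = block 0 (lift _).length
    rw [← h, length_block]

theorem length_palPrefix_succ (m : ℕ) :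
    (palPrefix (m + 1)).length = start (palPrefix m).length + 1 := by
  rw [start, ← palPrefix_eq_block]
  simp [palPrefix, lift]

theorem count_lift (u : List Letter) :
    (lift u).count 0 = u.length + 1 ∧ (lift u).count 1 = u.count 0 ∧
      (lift u).length = u.length + u.count 0 + u.count 1 + 1 := by
  induction u with
  | nil => simp [lift]
  | cons x u ih =>
    have h : lift (x :: u) = tau x ++ lift u := by simp [lift]
    rw [h]
    rcases letter_cases x with rfl | rfl | rfl <;> simp [tau, ih] <;> omega

/-- By `count_lift`, the numbers of `a`s and `b`s in a lift come from the lengths one and two steps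
earlier, each increased by one. -/
theorem length_palPrefix_add_three (m : ℕ) : (palPrefix (m + 3)).length =
    (palPrefix (m + 2)).length + (palPrefix (m + 1)).length + (palPrefix m).length + 3 := by
  have h0 := count_lift (palPrefix m)
  have h1 := count_lift (palPrefix (m + 1))
  have h2 := count_lift (palPrefix (m + 2))
  have h : ∀ m, lift (palPrefix m) = palPrefix (m + 1) := fun _ => rfl
  simp only [h, add_assoc, Nat.reduceAdd] at h0 h1 h2 ⊢
  omega

theorem k_add_four (m : ℕ) : k (m + 4) = (palPrefix m).length + 2 := by
  induction m using Nat.strong_induction_on with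
  | _ m ih =>
    match m with
    | 0 => rfl
    | 1 => rfl
    | 2 => rfl
    | m + 3 =>
      have h : k (m + 3 + 4) = k (m + 2 + 4) + k (m + 1 + 4) + k (m + 4) - 1 := rfl
      rw [h, ih m (by omega), ih (m + 1) (by omega), ih (m + 2) (by omega),
        length_palPrefix_add_three]
      omega

theorem two_mul_length_palPrefix (m : ℕ) : 2 * (palPrefix m).length + 3 + t m = t (m + 2) := by
  induction m using Nat.strong_induction_on with
  | _ m ih =>
    match m with
    | 0 => rfl
    | 1 => rfl
    | 2 => rfl
    | m + 3 =>
      have h0 := ih m (by omega)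
      have h1 := ih (m + 1) (by omega)
      have h2 := ih (m + 2) (by omega)
      have h := length_palPrefix_add_three m
      simp only [t] at h0 h1 h2 ⊢
      omega

theorem B_palPrefix_add_three (m : ℕ) : B (palPrefix (m + 3)).length =
    B (palPrefix (m + 2)).length + B (palPrefix (m + 1)).length + B (palPrefix m).length
      + (palPrefix (m + 3)).length := by
  have h0 : ∀ m, (palsFrom 0 (palPrefix (m + 1)).length).card =
      B (palPrefix m).length + ((palPrefix m).length + 1) := fun m => by
    rw [length_palPrefix_succ, card_palsFrom_zero, B_eq_card_pals]
  have h1 : ∀ m, (palsFrom 1 (palPrefix (m + 1)).length).card =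
      (palsFrom 0 (palPrefix m).length).card := fun m => by
    rw [length_palPrefix_succ]; exact card_palsFrom_add_one (x := 0) (by decide) _
  have h2 : ∀ m, (palsFrom 2 (palPrefix (m + 1)).length).card =
      (palsFrom 1 (palPrefix m).length).card := fun m => by
    rw [length_palPrefix_succ]; exact card_palsFrom_add_one (x := 1) (by decide) _
  have h3 := length_palPrefix_add_three m
  rw [B_eq_card_pals (palPrefix (m + 3)).length, card_pals, h2, h1 (m + 1), h1, h0, h0, h0]
  -- The three summands `length + 1` from the empty factors add up to the length of `palPrefix (m +
  -- 3)`.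
  omega

theorem B_palPrefix (m : ℕ) : (B (palPrefix m).length : ℚ) =
    (m : ℚ) / 44 * (8 * (t (m + 2) : ℚ) + 4 * (t (m + 1) : ℚ) - 2 * (t m : ℚ))
      - 1 / 44 * (9 * (t (m + 2) : ℚ) - 3 * (t m : ℚ)) + 3 / 4 := by
  induction m using Nat.strong_induction_on with
  | _ m ih =>
    match m with
    | 0 =>
      rw [B_eq_card_pals, show (pals (palPrefix 0).length).card = 0 by decide]
      norm_num [t]
    | 1 =>
      rw [B_eq_card_pals, show (pals (palPrefix 1).length).card = 1 by decide]
      norm_num [t]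
    | 2 =>
      rw [B_eq_card_pals, show (pals (palPrefix 2).length).card = 4 by decide]
      norm_num [t]
    | m + 3 =>
      have h0 := ih m (by omega)
      have h1 := ih (m + 1) (by omega)
      have h2 := ih (m + 2) (by omega)
      have hl : (2 * (palPrefix (m + 3)).length + 3 + t (m + 3) : ℚ) = t (m + 3 + 2) := by
        exact_mod_cast two_mul_length_palPrefix (m + 3)
      have hl' : ((palPrefix (m + 3)).length : ℚ) = (t (m + 3 + 2) - t (m + 3) - 3) / 2 := by
        linarith
      rw [B_palPrefix_add_three]
      push_cast
      rw [h0, h1, h2, hl']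
      -- Everything reduces to `t m`, `t (m + 1)`, `t (m + 2)`, leaving a polynomial identity.
      simp only [t]
      push_cast
      ring

end TribonacciPalindromes

theorem mainTheorem8 (m : ℕ) (hm : 1 ≤ m) :
    (TribonacciPalindromes.B (TribonacciPalindromes.k (m + 4) - 2) : ℚ) =
      (m : ℚ) / 44 *
          (8 * (TribonacciPalindromes.t (m + 2) : ℚ) + 4 * (TribonacciPalindromes.t (m + 1) : ℚ)
            - 2 * (TribonacciPalindromes.t m : ℚ))
        - 1 / 44 *
          (9 * (TribonacciPalindromes.t (m + 2) : ℚ) - 3 * (TribonacciPalindromes.t m : ℚ))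
        + 3 / 4 := by
  rw [TribonacciPalindromes.k_add_four, Nat.add_sub_cancel]
  exact TribonacciPalindromes.B_palPrefix m
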